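/- For a partition $\pi$ of $N$, let $[\pi]$ denote the irreducible complex representation of the symmetric group $\mathfrak S_N$ corresponding to $\pi$ (the Specht module of shape $\pi$, so that $[(N)]$ is the trivial representation and $[(1^N)]$ is the sign representation). Partitions that differ only by zero parts are identified. Let $m,n,N$ be non-negative integers, let $\gamma$ be a partition of $N$ with at most $mn$ non-zero parts, and let $t=(t_{ij})_{1\le i\le m,\,1\le j\le n}$ be an $m\times n$ tableau filled with the parts of $\gamma$, each part used once, with the remaining boxes filled by zeros. Assume that the entries of $t$ weakly decrease along every row and along every column. Let $\alpha$ and $\beta$ be the partitions of $N$ whose parts are the row sums and the column sums of $t$, respectively: $$\alpha_i=\sum_{j=1}^n t_{ij}\quad(1\le i\le m),\qquad \beta_j=\sum_{i=1}^m t_{ij}\quad(1\le j\le n).$$ Then $[\gamma]$ appears in $[\alpha]\otimes[\beta]$ (with the diagonal action of $\mathfrak S_N$): there is an injective $\mathfrak S_N$-equivariant linear map $[\gamma]\to[\alpha]\otimes[\beta]$. -/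

import Mathlib

/-- The Young diagram of a partition: the `i`-th row has as many cells as the `i`-th largest part
(rows and columns are indexed from `0`). -/
def partitionDiagram {N : ℕ} (p : N.Partition) : YoungDiagram :=
  YoungDiagram.ofRowLens (p.parts.sort (· ≥ ·)) (p.parts.pairwise_sort (· ≥ ·)).sortedGE

/-- The parts of `p` are the non-zero values of the finite family `f`, with multiplicities: `p` and
`f` differ only by the order and by zero parts. -/
def PartsAre {N : ℕ} {ι : Type*} [Fintype ι] (p : N.Partition) (f : ι → ℕ) : Prop :=
  p.parts = (Finset.univ.val.map f).filter (· ≠ 0)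

/-- A Young tableau of shape `μ` with entries `0, …, N - 1`, each used once. -/
abbrev BijTableau (μ : YoungDiagram) (N : ℕ) : Type := {c // c ∈ μ.cells} ≃ Fin N

/-- A tabloid of shape `μ` with entries `0, …, N - 1`: a tableau up to permutations of the entries
within the rows. It is given by the map which sends an entry to the index of its row. -/
def Tabloid (μ : YoungDiagram) (N : ℕ) : Type :=
  {r : Fin N → ℕ // ∀ i, (Finset.univ.filter fun x => r x = i).card = μ.rowLen i}

/-- `Equiv.Perm (Fin N)` acts on tabloids by permuting the entries: after the action of `σ`, the
entry `σ x` stands in the row where `x` stood. -/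
instance Tabloid.instMulAction (μ : YoungDiagram) (N : ℕ) :
    MulAction (Equiv.Perm (Fin N)) (Tabloid μ N) where
  smul σ r := ⟨fun x => r.1 (σ⁻¹ x), fun i => by
    rw [← r.2 i]
    refine Finset.card_bij (fun x _ => σ⁻¹ x) ?_ ?_ ?_
    · intro x hx
      simpa using hx
    · intro x _ y _ h
      exact σ⁻¹.injective h
    · intro y hy
      exact ⟨σ y, by simpa using hy, by simp⟩⟩
  one_smul _ := rfl
  mul_smul σ τ r := Subtype.ext (funext fun x => by
    change r.1 ((σ * τ)⁻¹ x) = r.1 (τ⁻¹ (σ⁻¹ x))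
    rw [mul_inv_rev, Equiv.Perm.mul_apply])

/-- The tabloid of a tableau. -/
def BijTableau.tabloid {μ : YoungDiagram} {N : ℕ} (T : BijTableau μ N) : Tabloid μ N :=
  ⟨fun x => (T.symm x).1.1, fun i => by
    rw [YoungDiagram.rowLen_eq_card]
    refine Finset.card_bij (fun x _ => (T.symm x).1) ?_ ?_ ?_
    · intro x hx
      rw [YoungDiagram.mem_row_iff]
      exact ⟨(T.symm x).2, by simpa using hx⟩
    · intro x _ y _ h
      exact T.symm.injective (Subtype.ext h)
    · intro c hc
      rw [YoungDiagram.mem_row_iff] at hc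
      exact ⟨T ⟨c, hc.1⟩, by simpa using hc.2, by simp⟩⟩

/-- The column group of a tableau: the permutations of the entries that keep every entry in its
column. -/
def BijTableau.columnGroup {μ : YoungDiagram} {N : ℕ} (T : BijTableau μ N) :
    Finset (Equiv.Perm (Fin N)) :=
  Finset.univ.filter fun σ => ∀ x, (T.symm (σ x)).1.2 = (T.symm x).1.2

/-- The permutation representation of the symmetric group on the tabloids of shape `μ`, over `ℂ`. -/
noncomputable abbrev tabloidRep (μ : YoungDiagram) (N : ℕ) :
    Representation ℂ (Equiv.Perm (Fin N)) (MonoidAlgebra ℂ (Tabloid μ N)) :=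
  Representation.ofMulAction ℂ (Equiv.Perm (Fin N)) (Tabloid μ N)

/-- The polytabloid of a tableau `T`: the signed sum of the tabloids `σ • {T}` over the column
group of `T`. -/
noncomputable def BijTableau.polytabloid {μ : YoungDiagram} {N : ℕ} (T : BijTableau μ N) :
    MonoidAlgebra ℂ (Tabloid μ N) :=
  ∑ σ ∈ T.columnGroup, MonoidAlgebra.single (σ • T.tabloid) ((Equiv.Perm.sign σ : ℤ) : ℂ)

theorem BijTableau.tabloid_trans {μ : YoungDiagram} {N : ℕ} (T : BijTableau μ N)
    (g : Equiv.Perm (Fin N)) : BijTableau.tabloid (T.trans g) = g • T.tabloid := rfl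

theorem BijTableau.tabloidRep_polytabloid {μ : YoungDiagram} {N : ℕ} (g : Equiv.Perm (Fin N))
    (T : BijTableau μ N) :
    tabloidRep μ N g T.polytabloid = BijTableau.polytabloid (T.trans g) := by
  unfold BijTableau.polytabloid
  rw [map_sum]
  refine Finset.sum_bij (fun σ _ => g * σ * g⁻¹) ?_ ?_ ?_ ?_
  · intro σ hσ
    simp only [BijTableau.columnGroup, Finset.mem_filter, Finset.mem_univ, true_and] at hσ ⊢
    intro x
    have h := hσ (g⁻¹ x)
    change (T.symm (g⁻¹ (g (σ (g⁻¹ x))))).1.2 = (T.symm (g⁻¹ x)).1.2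
    rw [show ∀ y, g⁻¹ (g y) = y from g.symm_apply_apply]
    exact h
  · intro σ _ τ _ h
    exact mul_left_cancel (mul_right_cancel h)
  · intro τ hτ
    refine ⟨g⁻¹ * τ * g, ?_, by group⟩
    simp only [BijTableau.columnGroup, Finset.mem_filter, Finset.mem_univ, true_and] at hτ ⊢
    intro x
    have h := hτ (g x)
    change (T.symm (g⁻¹ (τ (g x)))).1.2 = (T.symm (g⁻¹ (g x))).1.2 at h
    rw [show ∀ y, g⁻¹ (g y) = y from g.symm_apply_apply] at h
    exact h
  · intro σ _
    rw [Representation.ofMulAction_single, BijTableau.tabloid_trans]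
    congr 1
    · simp only [← mul_smul]
      congr 1
      group
    · simp [mul_right_comm]

/-- The Specht module of shape `μ`: the span of the polytabloids of all tableaux of shape `μ`. -/
noncomputable def spechtSubrep (μ : YoungDiagram) (N : ℕ) :
    Subrepresentation (tabloidRep μ N) where
  toSubmodule := Submodule.span ℂ (Set.range fun T : BijTableau μ N => T.polytabloid)
  apply_mem_toSubmodule g v hv := by
    induction hv using Submodule.span_induction with
    | mem x hx =>
      obtain ⟨T, rfl⟩ := hx
      exact Submodule.subset_span ⟨T.trans g, (T.tabloidRep_polytabloid g).symm⟩
    | zero => rw [map_zero]; exact Submodule.zero_mem _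
    | add x y _ _ hx hy => rw [map_add]; exact Submodule.add_mem _ hx hy
    | smul a x _ hx => rw [map_smul]; exact Submodule.smul_mem _ a hx

/-- The irreducible complex representation `[p]` of the symmetric group on `N` letters that
corresponds to the partition `p` of `N`, as a Specht module: `[(N)]` is the trivial representation
and `[(1, …, 1)]` is the sign. -/
noncomputable def spechtRep {N : ℕ} (p : N.Partition) :
    Representation ℂ (Equiv.Perm (Fin N)) (spechtSubrep (partitionDiagram p) N).toSubmodule :=
  (spechtSubrep (partitionDiagram p) N).toRepresentation

/-- `ρ` appears in `τ`: there is an injective equivariant linear map from `ρ` to `τ`. (For an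
irreducible `ρ`, this means multiplicity at least one.) -/
def AppearsIn {G V W : Type*} [Group G] [AddCommMonoid V] [Module ℂ V] [AddCommMonoid W] [Module ℂ W]
    (ρ : Representation ℂ G V) (τ : Representation ℂ G W) : Prop :=
  ∃ f : ρ.IntertwiningMap τ, Function.Injective f

/-! View `t` as a plane partition: a stack of `N` boxes `(i, j, k)` with `k < t i j`, labelled by
the entries. The vertical stacks are the rows of a tableau `T` of shape `γ`, whose column index is
the height `k`. The slices of constant `i` are the rows of a tableau `A` of shape `α`; monotonicity
of `t` makes the lines in direction `i` initial segments, so they can serve as the columns of `A`.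
The same holds for `B` of shape `β`, with `i` and `j` exchanged (`exists_bijTableau_of_slices`).

Merging stacks into slices in both directions sends a tabloid of shape `γ` to a pair of tabloids of
shapes `α` and `β`. Followed by equivariant projections to the Specht modules, this is an
equivariant map from the tabloid module of `γ` to `[α] ⊗ [β]`. It is injective on `[γ]` once it does
not kill the polytabloid of `T` (James' submodule argument).

To see this, take the coefficient of the image at the pair of tabloids of `A` and `B`. A column
permutation of `A` preserves `j` and `k`: it lies in the column group of `T` and fixes the tabloid
of `B`. Averaging over such permutations turns the tabloid of `A` into its polytabloid, on which the
projection is the identity; likewise for `B`. Without projections only `σ = 1` contributes, since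
preserving `i`, `j` and `k` fixes every box. The coefficient is therefore 1 (`appearsIn_tprod`). -/

open scoped TensorProduct

/-! ### Linear maps on permutation modules, and Maschke's theorem -/

namespace MonoidAlgebra

/-- The linear extension of a map on the basis of a monoid algebra. -/
noncomputable def linearLift {X V : Type*} [AddCommMonoid V] [Module ℂ V] (F : X → V) :
    MonoidAlgebra ℂ X →ₗ[ℂ] V :=
  Finsupp.linearCombination ℂ F ∘ₗ (coeffLinearEquiv ℂ).toLinearMap

theorem linearLift_single {X V : Type*} [AddCommMonoid V] [Module ℂ V] (F : X → V) (x : X) (c : ℂ) :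
    linearLift F (single x c) = c • F x := by
  simp [linearLift]

theorem linearMap_ext {X V : Type*} [AddCommMonoid V] [Module ℂ V]
    {f g : MonoidAlgebra ℂ X →ₗ[ℂ] V} (h : ∀ x, f (single x 1) = g (single x 1)) : f = g := by
  ext x
  simpa using h x

theorem linearMap_induction {X : Type*} {p : Submodule ℂ (MonoidAlgebra ℂ X)}
    (h : ∀ x, single x 1 ∈ p) (v : MonoidAlgebra ℂ X) : v ∈ p := by
  have : p.mkQ = 0 := linearMap_ext fun x => by simpa using h x
  have := congrArg (fun f => f v) this
  simpa using this

end MonoidAlgebra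

/-- A subrepresentation of a complex representation of a finite group is the image of an
equivariant projection. -/
theorem Subrepresentation.exists_equivariant_projection {G V : Type*} [Group G] [Finite G]
    [AddCommGroup V] [Module ℂ V] {ρ : Representation ℂ G V} (S : Subrepresentation ρ) :
    ∃ p : ρ.IntertwiningMap S.toRepresentation, ∀ v : S.toSubmodule, p v = v := by
  classical
  have := Fintype.ofFinite G
  obtain ⟨π, hπ⟩ := S.toSubmodule.exists_isCompl
  obtain ⟨π, hπ⟩ : ∃ π : V →ₗ[ℂ] S.toSubmodule, ∀ v : S.toSubmodule, π v = v :=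
    ⟨S.toSubmodule.projectionOnto π hπ, fun v => by simp⟩
  -- Averaging an arbitrary linear projection over the group makes it equivariant.
  refine ⟨LinearMap.intertwiningMap_of_isIntertwiningMap _ _
    ((Fintype.card G : ℂ)⁻¹ • ∑ g : G, S.toRepresentation g⁻¹ ∘ₗ π ∘ₗ ρ g) ?_, ?_⟩
  · intro g v
    simp only [LinearMap.smul_apply, LinearMap.sum_apply, LinearMap.comp_apply, map_smul, map_sum]
    congr 1
    refine Fintype.sum_bijective (· * g) (Group.mulRight_bijective g) _ _ fun h => ?_
    simp [← Module.End.mul_apply, ← map_mul]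
  · intro v
    have key : ∀ g : G, S.toRepresentation g⁻¹ (π (ρ g v)) = v := fun g => by
      have : ρ g v = (S.toRepresentation g v : S.toSubmodule) := rfl
      rw [this, hπ, ← Module.End.mul_apply, ← map_mul]
      simp
    simp [key]
    rw [← Nat.cast_smul_eq_nsmul ℂ, smul_smul, inv_mul_cancel₀ (by simp), one_smul]

/-! ### Column antisymmetrizers on tabloids -/

namespace BijTableau

variable {μ : YoungDiagram} {N : ℕ} (T : BijTableau μ N)

/-- The row in which an entry of a tableau stands. -/
abbrev rowIdx (x : Fin N) : ℕ := (T.symm x).1.1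

/-- The column in which an entry of a tableau stands. -/
abbrev colIdx (x : Fin N) : ℕ := (T.symm x).1.2

theorem idx_injective {x y : Fin N} (hr : T.rowIdx x = T.rowIdx y)
    (hc : T.colIdx x = T.colIdx y) : x = y :=
  T.symm.injective (Subtype.ext (Prod.ext hr hc))

theorem exists_idx {i j : ℕ} (h : i < μ.colLen j) :
    ∃ x, T.rowIdx x = i ∧ T.colIdx x = j := by
  rw [← YoungDiagram.mem_iff_lt_colLen] at h
  exact ⟨T ⟨(i, j), h⟩, by simp [rowIdx], by simp [colIdx]⟩

theorem rowIdx_lt (x : Fin N) : T.rowIdx x < μ.colLen (T.colIdx x) :=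
  YoungDiagram.mem_iff_lt_colLen.1 (T.symm x).2

theorem mem_columnGroup {σ : Equiv.Perm (Fin N)} :
    σ ∈ T.columnGroup ↔ ∀ x, T.colIdx (σ x) = T.colIdx x := by
  simp [columnGroup]

theorem mul_mem_columnGroup {σ τ : Equiv.Perm (Fin N)} (hσ : σ ∈ T.columnGroup)
    (hτ : τ ∈ T.columnGroup) : σ * τ ∈ T.columnGroup := by
  rw [mem_columnGroup] at *
  intro x
  rw [Equiv.Perm.mul_apply, hσ, hτ]

theorem inv_mem_columnGroup {σ : Equiv.Perm (Fin N)} (hσ : σ ∈ T.columnGroup) :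
    σ⁻¹ ∈ T.columnGroup := by
  rw [mem_columnGroup] at *
  intro x
  simpa using (hσ (σ⁻¹ x)).symm

theorem one_mem_columnGroup : 1 ∈ T.columnGroup := by
  simp [columnGroup]

theorem sum_columnGroup_mul_right {V : Type*} [AddCommMonoid V] {τ : Equiv.Perm (Fin N)}
    (hτ : τ ∈ T.columnGroup) (F : Equiv.Perm (Fin N) → V) :
    ∑ σ ∈ T.columnGroup, F (σ * τ) = ∑ σ ∈ T.columnGroup, F σ :=
  Finset.sum_bij' (fun σ _ => σ * τ) (fun σ _ => σ * τ⁻¹)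
    (fun _ hσ => T.mul_mem_columnGroup hσ hτ)
    (fun _ hσ => T.mul_mem_columnGroup hσ (T.inv_mem_columnGroup hτ))
    (by simp) (by simp) (by simp)

theorem sum_columnGroup_inv {V : Type*} [AddCommMonoid V] (F : Equiv.Perm (Fin N) → V) :
    ∑ σ ∈ T.columnGroup, F σ⁻¹ = ∑ σ ∈ T.columnGroup, F σ :=
  Finset.sum_bij' (fun σ _ => σ⁻¹) (fun σ _ => σ⁻¹)
    (fun _ hσ => T.inv_mem_columnGroup hσ) (fun _ hσ => T.inv_mem_columnGroup hσ)
    (by simp) (by simp) (by simp)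

/-- The signed sum over the column group of a tableau, acting on a representation. -/
noncomputable def antisymmetrizer {V : Type*} [AddCommMonoid V] [Module ℂ V]
    (ρ : Representation ℂ (Equiv.Perm (Fin N)) V) : V →ₗ[ℂ] V :=
  ∑ σ ∈ T.columnGroup, ((Equiv.Perm.sign σ : ℤ) : ℂ) • ρ σ

theorem antisymmetrizer_apply {V : Type*} [AddCommMonoid V] [Module ℂ V]
    (ρ : Representation ℂ (Equiv.Perm (Fin N)) V) (v : V) :
    T.antisymmetrizer ρ v = ∑ σ ∈ T.columnGroup, ((Equiv.Perm.sign σ : ℤ) : ℂ) • ρ σ v := by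
  simp [antisymmetrizer, LinearMap.sum_apply]

theorem antisymmetrizer_single (s : Tabloid μ N) :
    T.antisymmetrizer (tabloidRep μ N) (MonoidAlgebra.single s 1) =
      ∑ σ ∈ T.columnGroup, MonoidAlgebra.single (σ • s) ((Equiv.Perm.sign σ : ℤ) : ℂ) := by
  simp [antisymmetrizer_apply, Representation.ofMulAction_single, MonoidAlgebra.smul_single]

theorem antisymmetrizer_tabloid :
    T.antisymmetrizer (tabloidRep μ N) (MonoidAlgebra.single T.tabloid 1) = T.polytabloid :=
  T.antisymmetrizer_single _

theorem antisymmetrizer_apply_of_mem {V : Type*} [AddCommMonoid V] [Module ℂ V]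
    (ρ : Representation ℂ (Equiv.Perm (Fin N)) V) {τ : Equiv.Perm (Fin N)}
    (hτ : τ ∈ T.columnGroup) (v : V) :
    T.antisymmetrizer ρ (ρ τ v) = ((Equiv.Perm.sign τ : ℤ) : ℂ) • T.antisymmetrizer ρ v := by
  rw [antisymmetrizer_apply, antisymmetrizer_apply,
    ← T.sum_columnGroup_mul_right hτ fun σ => ((Equiv.Perm.sign σ : ℤ) : ℂ) • ρ σ v,
    Finset.smul_sum]
  refine Finset.sum_congr rfl fun σ _ => ?_
  rw [smul_smul, map_mul, map_mul, Module.End.mul_apply]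
  congr 1
  rcases Int.units_eq_one_or (Equiv.Perm.sign τ) with h | h <;> simp [h]

/-- The number of entries of a column that stand in the first `h` rows of the tableau bounds the
number of entries of that column to which a map injective on the column gives values below `h`. -/
theorem card_column_le {s : Fin N → ℕ}
    (hs : ∀ x y, T.colIdx x = T.colIdx y → s x = s y → x = y) (h j : ℕ) :
    (Finset.univ.filter fun x => s x < h ∧ T.colIdx x = j).card ≤
      (Finset.univ.filter fun x => T.rowIdx x < h ∧ T.colIdx x = j).card := by
  classical
  -- If column `j` has at least `h` cells, the right side meets each of the first `h` rows, while
  -- injectivity bounds the left by `h`. Otherwise the right side is the whole column.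
  rcases le_total h (μ.colLen j) with hj | hj
  · calc _ ≤ (Finset.range h).card := by
          refine Finset.card_le_card_of_injOn s (by intro x; simp +contextual) ?_
          intro x hx y hy hxy
          simp only [Finset.coe_filter, Finset.mem_univ, true_and, Set.mem_ofPred_eq] at hx hy
          exact hs x y (hx.2.trans hy.2.symm) hxy
      _ ≤ _ := by
          refine Finset.card_le_card_of_surjOn T.rowIdx ?_
          intro i hi
          simp only [Finset.coe_range, Set.mem_Iio] at hi
          obtain ⟨x, hx, hx'⟩ := T.exists_idx (hi.trans_le hj)
          exact ⟨x, by simp [hx, hx', hi], hx⟩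
  · refine Finset.card_le_card fun x => ?_
    simp only [Finset.mem_filter, Finset.mem_univ, true_and]
    rintro ⟨_, rfl⟩
    exact ⟨(T.rowIdx_lt x).trans_le hj, rfl⟩

theorem _root_.Tabloid.card_lt_eq (s s' : Tabloid μ N) (h : ℕ) :
    (Finset.univ.filter fun x => s.1 x < h).card =
      (Finset.univ.filter fun x => s'.1 x < h).card := by
  have key : ∀ s : Tabloid μ N, (Finset.univ.filter fun x => s.1 x < h).card =
      ∑ i ∈ Finset.range h, μ.rowLen i := fun s => by
    rw [Finset.card_eq_sum_card_fiberwise (f := s.1) (t := Finset.range h)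
      (by intro x; simp)]
    refine Finset.sum_congr rfl fun i hi => ?_
    rw [← s.2 i, Finset.filter_filter]
    congr 1
    ext x
    simp only [Finset.mem_filter, Finset.mem_univ, true_and, Finset.mem_range] at hi ⊢
    omega
  rw [key, key]

/-- All tabloids have equally many entries in the first `h` rows. For `h` the length of the column
of `x`, a violation at `x` would make the count for `s` strictly smaller than that for `T` in this
column, and it is no larger in any other. -/
theorem tabloid_lt_colLen {s : Tabloid μ N}
    (hs : ∀ x y, T.colIdx x = T.colIdx y → s.1 x = s.1 y → x = y) (x : Fin N) :
    s.1 x < μ.colLen (T.colIdx x) := by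
  classical
  by_contra! hx
  set h := μ.colLen (T.colIdx x) with hh
  refine absurd (s.card_lt_eq T.tabloid h) (ne_of_lt ?_)
  have hm : ∀ r : Fin N → ℕ, ∀ y ∈ Finset.univ.filter fun y => r y < h,
      T.colIdx y ∈ Finset.univ.image T.colIdx := fun r y _ => by simp
  rw [Finset.card_eq_sum_card_fiberwise (hm s.1),
    Finset.card_eq_sum_card_fiberwise (hm T.tabloid.1)]
  simp only [Finset.filter_filter]
  refine Finset.sum_lt_sum (fun j _ => T.card_column_le hs h j) ⟨T.colIdx x, by simp, ?_⟩
  refine Finset.card_lt_card ((Finset.ssubset_iff_of_subset ?_).2 ⟨x, ?_, ?_⟩)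
  · intro y
    simp only [Finset.mem_filter, Finset.mem_univ, true_and]
    rintro ⟨_, hy⟩
    exact ⟨by rw [hh, ← hy]; exact T.rowIdx_lt y, hy⟩
  · simp only [Finset.mem_filter, Finset.mem_univ, true_and, and_true]
    exact T.rowIdx_lt x
  · simp [hx]

/-- A tabloid with no two entries of a column of `T` in the same row is obtained from the tabloid of
`T` by a column permutation. -/
theorem exists_columnGroup_smul_eq {s : Tabloid μ N}
    (hs : ∀ x y, T.colIdx x = T.colIdx y → s.1 x = s.1 y → x = y) :
    ∃ σ ∈ T.columnGroup, σ • T.tabloid = s := by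
  -- `g x` is the entry of `T` in the column of `x` and in row `s.1 x`. The action on tabloids
  -- precomposes with the inverse, so the required permutation is the inverse of `g`.
  choose g hg hg' using fun x => T.exists_idx (T.tabloid_lt_colLen hs x)
  have hinj : Function.Injective g := fun x y hxy =>
    hs x y (by rw [← hg' x, ← hg' y, hxy]) (by rw [← hg x, ← hg y, hxy])
  let τ : Equiv.Perm (Fin N) := Equiv.ofBijective g (Finite.injective_iff_bijective.1 hinj)
  refine ⟨τ⁻¹, T.inv_mem_columnGroup (T.mem_columnGroup.2 hg'), Subtype.ext (funext fun x => ?_)⟩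
  change T.rowIdx (τ⁻¹⁻¹ x) = s.1 x
  rw [inv_inv]
  exact hg x

/-- On a basis tabloid there are two cases: if two entries of a column of `T` share a row, their
transposition fixes the tabloid and forces the value to be its own negative; otherwise the tabloid
is a column translate of that of `T`, and the value is plus or minus the polytabloid. -/
theorem antisymmetrizer_mem_span (v : MonoidAlgebra ℂ (Tabloid μ N)) :
    T.antisymmetrizer (tabloidRep μ N) v ∈ ℂ ∙ T.polytabloid := by
  classical
  refine MonoidAlgebra.linearMap_induction
    (p := (ℂ ∙ T.polytabloid).comap (T.antisymmetrizer (tabloidRep μ N))) (fun s => ?_) v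
  rw [Submodule.mem_comap]
  by_cases hs : ∀ x y, T.colIdx x = T.colIdx y → s.1 x = s.1 y → x = y
  · obtain ⟨σ, hσ, rfl⟩ := T.exists_columnGroup_smul_eq hs
    rw [← Representation.ofMulAction_single, T.antisymmetrizer_apply_of_mem _ hσ,
      T.antisymmetrizer_tabloid]
    exact Submodule.smul_mem _ _ (Submodule.mem_span_singleton_self _)
  · push Not at hs
    obtain ⟨x, y, hc, hr, hxy⟩ := hs
    have hmem : Equiv.swap x y ∈ T.columnGroup := T.mem_columnGroup.2 fun z => by
      rw [Equiv.swap_apply_def]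
      split_ifs with h1 h2
      · rw [h1, hc]
      · rw [h2, hc]
      · rfl
    have hfix : Equiv.swap x y • s = s := Subtype.ext (funext fun z => by
      change s.1 ((Equiv.swap x y)⁻¹ z) = s.1 z
      rw [Equiv.swap_inv, Equiv.swap_apply_def]
      split_ifs with h1 h2
      · rw [h1, hr]
      · rw [h2, hr]
      · rfl)
    have h := T.antisymmetrizer_apply_of_mem (tabloidRep μ N) hmem (MonoidAlgebra.single s 1)
    rw [Representation.ofMulAction_single, hfix, Equiv.Perm.sign_swap hxy] at h
    have h0 : T.antisymmetrizer (tabloidRep μ N) (MonoidAlgebra.single s 1) = 0 := by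
      have h2 : (2 : ℂ) • T.antisymmetrizer (tabloidRep μ N) (MonoidAlgebra.single s 1) = 0 := by
        rw [two_smul, add_eq_zero_iff_eq_neg]
        simpa using h
      exact (smul_eq_zero.1 h2).resolve_left two_ne_zero
    rw [h0]
    exact Submodule.zero_mem _

/-- The right side is the pairing of `v` with the polytabloid of `T`: the antisymmetrizer is
self-adjoint. -/
theorem coeff_antisymmetrizer (v : MonoidAlgebra ℂ (Tabloid μ N)) :
    (T.antisymmetrizer (tabloidRep μ N) v).coeff T.tabloid =
      ∑ σ ∈ T.columnGroup, ((Equiv.Perm.sign σ : ℤ) : ℂ) * v.coeff (σ • T.tabloid) := by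
  rw [antisymmetrizer_apply, ← T.sum_columnGroup_inv]
  simp [Representation.coeff_ofMulAction, Finsupp.finsetSum_apply]

end BijTableau

/-! ### Injectivity on the Specht module -/

/-- Otherwise `v` is orthogonal to every polytabloid for the Hermitian form, hence to the Specht
module, hence to itself. -/
theorem exists_antisymmetrizer_ne_zero {μ : YoungDiagram} {N : ℕ}
    {v : MonoidAlgebra ℂ (Tabloid μ N)} (hv : v ∈ (spechtSubrep μ N).toSubmodule) (h0 : v ≠ 0) :
    ∃ T : BijTableau μ N, T.antisymmetrizer (tabloidRep μ N) v ≠ 0 := by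
  by_contra! h
  let L : MonoidAlgebra ℂ (Tabloid μ N) →ₗ[ℂ] ℂ :=
    MonoidAlgebra.linearLift fun s => (starRingEnd ℂ) (v.coeff s)
  have hL : (spechtSubrep μ N).toSubmodule ≤ LinearMap.ker L := by
    refine Submodule.span_le.2 ?_
    rintro _ ⟨T, rfl⟩
    have hT := congrArg (starRingEnd ℂ) (T.coeff_antisymmetrizer v)
    rw [h T] at hT
    simp only [map_sum, map_mul] at hT
    simp only [SetLike.mem_coe, LinearMap.mem_ker, BijTableau.polytabloid, map_sum, L,
      MonoidAlgebra.linearLift_single]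
    simpa using hT.symm
  have hLv : L v = 0 := hL hv
  apply h0
  have : ∑ s ∈ v.coeff.support, ‖v.coeff s‖ ^ 2 = 0 := by
    simp only [L, MonoidAlgebra.linearLift, LinearMap.comp_apply,
      Finsupp.linearCombination_apply, Finsupp.sum] at hLv
    have h2 : ∑ s ∈ v.coeff.support, ((‖v.coeff s‖ : ℂ)) ^ 2 = 0 := by
      rw [← hLv]
      exact Finset.sum_congr rfl fun s _ => (Complex.mul_conj' _).symm
    exact_mod_cast h2
  rw [Finset.sum_eq_zero_iff_of_nonneg fun _ _ => by positivity] at this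
  ext s
  by_contra hs
  have := this s (by simpa using hs)
  simp at this
  exact hs (by simpa using this)

/-- An equivariant map from the tabloid module which does not kill some polytabloid is injective on
the Specht module. -/
theorem injective_comp_subtype_of_polytabloid_ne_zero {μ : YoungDiagram} {N : ℕ} {V : Type*}
    [AddCommMonoid V] [Module ℂ V] {τ : Representation ℂ (Equiv.Perm (Fin N)) V}
    (f : (tabloidRep μ N).IntertwiningMap τ) (T : BijTableau μ N) (hT : f T.polytabloid ≠ 0) :
    Function.Injective fun v : (spechtSubrep μ N).toSubmodule => f v := by
  have hinj : ∀ v ∈ (spechtSubrep μ N).toSubmodule, f v = 0 → v = 0 := by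
    intro v hv hfv
    by_contra h0
    obtain ⟨T', hT'⟩ := exists_antisymmetrizer_ne_zero hv h0
    obtain ⟨c, hc⟩ := Submodule.mem_span_singleton.1 (T'.antisymmetrizer_mem_span v)
    have hf : f (T'.antisymmetrizer (tabloidRep μ N) v) = 0 := by
      rw [BijTableau.antisymmetrizer_apply, map_sum]
      refine Finset.sum_eq_zero fun σ _ => ?_
      rw [map_smul, f.isIntertwining, hfv, map_zero, smul_zero]
    rw [← hc, map_smul] at hf
    have hc0 : c ≠ 0 := by
      rintro rfl
      exact hT' (by rw [← hc, zero_smul])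
    -- `f` kills the polytabloid of `T'`; any two tableaux are translates, so it kills that of `T`
    -- too.
    have hg : T = T'.trans (T'.symm.trans T) := by
      ext; simp
    apply hT
    rw [hg, ← BijTableau.tabloidRep_polytabloid, f.isIntertwining,
      (IsUnit.mk0 c hc0).smul_eq_zero.1 hf, map_zero]
  intro v w hvw
  have := hinj (v - w : (spechtSubrep μ N).toSubmodule) (v - w).2 (by
    have hvw : f v = f w := hvw
    rw [Submodule.coe_sub, sub_eq_add_neg, map_add, hvw, ← map_add, add_neg_cancel, map_zero])
  exact Subtype.ext (sub_eq_zero.1 (by simpa using this))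

/-! ### Merging rows, and nonvanishing of the signed sum -/

theorem Tabloid.exists_perm_apply_eq {μ : YoungDiagram} {N : ℕ} (s s' : Tabloid μ N) :
    ∃ g : Equiv.Perm (Fin N), ∀ x, s'.1 (g x) = s.1 x := by
  have h : ∀ i, Nonempty ({x // s.1 x = i} ≃ {x // s'.1 x = i}) := fun i => by
    refine ⟨Fintype.equivOfCardEq ?_⟩
    rw [Fintype.card_subtype, Fintype.card_subtype, s.2 i, s'.2 i]
  exact ⟨Equiv.ofFiberEquiv fun i => (h i).some, fun x => Equiv.ofFiberEquiv_map _ x⟩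

/-- Merging and relabelling the rows of a tabloid. -/
def Tabloid.mapRows {lam μ : YoungDiagram} {N : ℕ} (ξ : ℕ → ℕ) (s₀ : Tabloid lam N)
    (r₀ : Tabloid μ N) (h : ∀ x, ξ (s₀.1 x) = r₀.1 x) (s : Tabloid lam N) : Tabloid μ N :=
  ⟨fun x => ξ (s.1 x), fun i => by
    obtain ⟨g, hg⟩ := s.exists_perm_apply_eq s₀
    rw [← r₀.2 i]
    refine Finset.card_equiv g fun x => ?_
    simp [← hg, h]⟩

namespace BijTableau

variable {lam μ ν : YoungDiagram} {N : ℕ}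

/-- The signed sum over the column group of `T` of the values of a bilinear map at the translates of
a pair of tabloids. -/
noncomputable def signedSum {W : Type*} [AddCommGroup W] [Module ℂ W] (T : BijTableau lam N)
    (A : BijTableau μ N) (B : BijTableau ν N)
    (Φ : MonoidAlgebra ℂ (Tabloid μ N) →ₗ[ℂ] MonoidAlgebra ℂ (Tabloid ν N) →ₗ[ℂ] W) : W :=
  ∑ σ ∈ T.columnGroup, ((Equiv.Perm.sign σ : ℤ) : ℂ) •
    Φ (MonoidAlgebra.single (σ • A.tabloid) 1) (MonoidAlgebra.single (σ • B.tabloid) 1)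

theorem signedSum_flip {W : Type*} [AddCommGroup W] [Module ℂ W] (T : BijTableau lam N)
    (A : BijTableau μ N) (B : BijTableau ν N)
    (Φ : MonoidAlgebra ℂ (Tabloid μ N) →ₗ[ℂ] MonoidAlgebra ℂ (Tabloid ν N) →ₗ[ℂ] W) :
    T.signedSum B A Φ.flip = T.signedSum A B Φ := rfl

/-- The column group of `A` lies in that of `T` and fixes the tabloid of `B`, so replacing `σ` by `σ
* τ` and summing over these `τ` assembles the polytabloid of `A` in the first slot. -/
theorem card_smul_signedSum {W : Type*} [AddCommGroup W] [Module ℂ W] (T : BijTableau lam N)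
    (A : BijTableau μ N) (B : BijTableau ν N)
    (hA : ∀ x y, A.colIdx x = A.colIdx y → B.rowIdx x = B.rowIdx y ∧ T.colIdx x = T.colIdx y)
    (Φ : MonoidAlgebra ℂ (Tabloid μ N) →ₗ[ℂ] MonoidAlgebra ℂ (Tabloid ν N) →ₗ[ℂ] W) :
    (A.columnGroup.card : ℂ) • T.signedSum A B Φ =
      ∑ σ ∈ T.columnGroup, ((Equiv.Perm.sign σ : ℤ) : ℂ) •
        Φ (tabloidRep μ N σ A.polytabloid) (MonoidAlgebra.single (σ • B.tabloid) 1) := by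
  have hmem : ∀ τ ∈ A.columnGroup, τ ∈ T.columnGroup := fun τ hτ =>
    T.mem_columnGroup.2 fun x => (hA _ _ (A.mem_columnGroup.1 hτ x)).2
  have hfix : ∀ τ ∈ A.columnGroup, τ • B.tabloid = B.tabloid := fun τ hτ =>
    Subtype.ext (funext fun x => (hA _ _ (A.mem_columnGroup.1 (A.inv_mem_columnGroup hτ) x)).1)
  have h1 : ∀ σ : Equiv.Perm (Fin N), ((Equiv.Perm.sign σ : ℤ) : ℂ) •
      Φ (tabloidRep μ N σ A.polytabloid) (MonoidAlgebra.single (σ • B.tabloid) 1) =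
      ∑ τ ∈ A.columnGroup, ((Equiv.Perm.sign (σ * τ) : ℤ) : ℂ) •
        Φ (MonoidAlgebra.single ((σ * τ) • A.tabloid) 1)
          (MonoidAlgebra.single ((σ * τ) • B.tabloid) 1) := fun σ => by
    rw [← A.antisymmetrizer_tabloid, antisymmetrizer_apply, map_sum, map_sum, LinearMap.sum_apply,
      Finset.smul_sum]
    refine Finset.sum_congr rfl fun τ hτ => ?_
    rw [map_smul, map_smul, LinearMap.smul_apply, smul_smul, ← Module.End.mul_apply, ← map_mul,
      Representation.ofMulAction_single, mul_smul σ τ B.tabloid, hfix τ hτ]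
    simp
  rw [Finset.sum_congr rfl fun σ _ => h1 σ, Finset.sum_comm,
    Finset.sum_congr rfl fun τ hτ => T.sum_columnGroup_mul_right (hmem τ hτ) fun σ =>
      ((Equiv.Perm.sign σ : ℤ) : ℂ) • Φ (MonoidAlgebra.single (σ • A.tabloid) 1)
        (MonoidAlgebra.single (σ • B.tabloid) 1),
    Finset.sum_const, ← Nat.cast_smul_eq_nsmul ℂ]
  rfl

/-- This is what removes a projection to the Specht module from the first slot. -/
theorem signedSum_congr {W : Type*} [AddCommGroup W] [Module ℂ W] (T : BijTableau lam N)
    (A : BijTableau μ N) (B : BijTableau ν N)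
    (hA : ∀ x y, A.colIdx x = A.colIdx y → B.rowIdx x = B.rowIdx y ∧ T.colIdx x = T.colIdx y)
    {Φ Ψ : MonoidAlgebra ℂ (Tabloid μ N) →ₗ[ℂ] MonoidAlgebra ℂ (Tabloid ν N) →ₗ[ℂ] W}
    (h : ∀ v ∈ (spechtSubrep μ N).toSubmodule, Φ v = Ψ v) :
    T.signedSum A B Φ = T.signedSum A B Ψ := by
  have h0 : (A.columnGroup.card : ℂ) ≠ 0 :=
    Nat.cast_ne_zero.2 (Finset.card_ne_zero_of_mem A.one_mem_columnGroup)
  refine smul_right_injective W h0 ?_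
  change (A.columnGroup.card : ℂ) • _ = (A.columnGroup.card : ℂ) • _
  rw [card_smul_signedSum T A B hA, card_smul_signedSum T A B hA]
  refine Finset.sum_congr rfl fun σ _ => ?_
  rw [h _ ((spechtSubrep μ N).apply_mem_toSubmodule σ (Submodule.subset_span ⟨A, rfl⟩))]

/-- The bilinear form that multiplies the coefficients at two given tabloids. -/
noncomputable def coeffMul (a : Tabloid μ N) (b : Tabloid ν N) :
    MonoidAlgebra ℂ (Tabloid μ N) →ₗ[ℂ] MonoidAlgebra ℂ (Tabloid ν N) →ₗ[ℂ] ℂ :=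
  (LinearMap.mul ℂ ℂ).compl₁₂
    (Finsupp.lapply a ∘ₗ (MonoidAlgebra.coeffLinearEquiv ℂ).toLinearMap)
    (Finsupp.lapply b ∘ₗ (MonoidAlgebra.coeffLinearEquiv ℂ).toLinearMap)

theorem coeffMul_apply (a : Tabloid μ N) (b : Tabloid ν N) (v : MonoidAlgebra ℂ (Tabloid μ N))
    (w : MonoidAlgebra ℂ (Tabloid ν N)) : coeffMul a b v w = v.coeff a * w.coeff b := rfl

theorem signedSum_coeffMul (T : BijTableau lam N) (A : BijTableau μ N) (B : BijTableau ν N)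
    (hinj : ∀ x y, A.rowIdx x = A.rowIdx y → B.rowIdx x = B.rowIdx y →
      T.colIdx x = T.colIdx y → x = y) :
    T.signedSum A B (coeffMul A.tabloid B.tabloid) = 1 := by
  classical
  rw [signedSum, Finset.sum_eq_single_of_mem 1 T.one_mem_columnGroup]
  · simp [coeffMul_apply]
  · intro σ hσ h1
    rw [coeffMul_apply, MonoidAlgebra.coeff_single, MonoidAlgebra.coeff_single,
      Finsupp.single_apply, Finsupp.single_apply]
    split_ifs with ha hb
    · refine absurd (inv_eq_one.1 (Equiv.ext fun x => ?_)) h1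
      exact hinj _ _ (congrFun (congrArg Subtype.val ha) x) (congrFun (congrArg Subtype.val hb) x)
        (T.mem_columnGroup.1 (T.inv_mem_columnGroup hσ) x)
    all_goals simp

/-- If the entries of `T`, `A`, `B` are three-dimensional coordinates (the rows of `A`, the rows of
`B`, the columns of `T`), and the rows of `T` and the columns of `A` and `B` lie in lines parallel to
the axes, then the Specht module of `T` appears in the product of those of `A` and `B`. -/
theorem appearsIn_tprod (T : BijTableau lam N) (A : BijTableau μ N) (B : BijTableau ν N)
    (hT : ∀ x y, T.rowIdx x = T.rowIdx y → A.rowIdx x = A.rowIdx y ∧ B.rowIdx x = B.rowIdx y)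
    (hA : ∀ x y, A.colIdx x = A.colIdx y → B.rowIdx x = B.rowIdx y ∧ T.colIdx x = T.colIdx y)
    (hB : ∀ x y, B.colIdx x = B.colIdx y → A.rowIdx x = A.rowIdx y ∧ T.colIdx x = T.colIdx y)
    (hinj : ∀ x y, A.rowIdx x = A.rowIdx y → B.rowIdx x = B.rowIdx y →
      T.colIdx x = T.colIdx y → x = y) :
    AppearsIn (spechtSubrep lam N).toRepresentation
      (Representation.tprod (spechtSubrep μ N).toRepresentation
        (spechtSubrep ν N).toRepresentation) := by
  obtain ⟨p, hp⟩ := (spechtSubrep μ N).exists_equivariant_projection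
  obtain ⟨q, hq⟩ := (spechtSubrep ν N).exists_equivariant_projection
  -- By `hT` the row in `T` determines the row in `A`. The default value 0 is taken only at indices
  -- that are not rows of `T`.
  have hξ : ∀ x, Function.extend T.rowIdx A.rowIdx 0 (T.tabloid.1 x) = A.tabloid.1 x :=
    Function.FactorsThrough.extend_apply (fun x y h => (hT x y h).1) 0
  have hη : ∀ x, Function.extend T.rowIdx B.rowIdx 0 (T.tabloid.1 x) = B.tabloid.1 x :=
    Function.FactorsThrough.extend_apply (fun x y h => (hT x y h).2) 0
  let F : MonoidAlgebra ℂ (Tabloid lam N) →ₗ[ℂ]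
      (spechtSubrep μ N).toSubmodule ⊗[ℂ] (spechtSubrep ν N).toSubmodule :=
    MonoidAlgebra.linearLift fun s =>
      p (MonoidAlgebra.single (Tabloid.mapRows _ _ _ hξ s) 1) ⊗ₜ
        q (MonoidAlgebra.single (Tabloid.mapRows _ _ _ hη s) 1)
  have hF : ∀ (g : Equiv.Perm (Fin N)) v, F (tabloidRep lam N g v) =
      Representation.tprod (spechtSubrep μ N).toRepresentation
        (spechtSubrep ν N).toRepresentation g (F v) := by
    intro g v
    refine congrArg (fun f => f v) (MonoidAlgebra.linearMap_ext
      (f := F ∘ₗ tabloidRep lam N g)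
      (g := Representation.tprod (spechtSubrep μ N).toRepresentation
        (spechtSubrep ν N).toRepresentation g ∘ₗ F) fun s => ?_)
    simp only [LinearMap.comp_apply, Representation.ofMulAction_single, F,
      MonoidAlgebra.linearLift_single, one_smul, Representation.tprod_apply,
      TensorProduct.map_tmul, ← Representation.IntertwiningMap.isIntertwining]
    rfl
  let f := LinearMap.intertwiningMap_of_isIntertwiningMap _ _ F hF
  have hne : f T.polytabloid ≠ 0 := by
    intro h0
    let ι₁ := (spechtSubrep μ N).toSubmodule.subtype
    let ι₂ := (spechtSubrep ν N).toSubmodule.subtype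
    let Θ := coeffMul A.tabloid B.tabloid
    have h1 : TensorProduct.lift (Θ.compl₁₂ ι₁ ι₂) (f T.polytabloid) =
        T.signedSum A B (Θ.compl₁₂ (ι₁ ∘ₗ p.toLinearMap) (ι₂ ∘ₗ q.toLinearMap)) := by
      change TensorProduct.lift (Θ.compl₁₂ ι₁ ι₂) (F T.polytabloid) = _
      simp only [polytabloid, map_sum, F, MonoidAlgebra.linearLift_single, map_smul, signedSum,
        TensorProduct.lift.tmul]
      refine Finset.sum_congr rfl fun σ _ => ?_
      have h4 : Tabloid.mapRows _ _ _ hξ (σ • T.tabloid) = σ • A.tabloid :=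
        Subtype.ext (funext fun x => hξ (σ⁻¹ x))
      have h5 : Tabloid.mapRows _ _ _ hη (σ • T.tabloid) = σ • B.tabloid :=
        Subtype.ext (funext fun x => hη (σ⁻¹ x))
      rw [h4, h5]
      rfl
    -- The projections go one at a time: `p` while `q` is still present, then `q` after flipping the
    -- two slots.
    have h2 : T.signedSum A B (Θ.compl₁₂ (ι₁ ∘ₗ p.toLinearMap) (ι₂ ∘ₗ q.toLinearMap)) =
        T.signedSum A B (Θ.compl₁₂ LinearMap.id (ι₂ ∘ₗ q.toLinearMap)) :=
      signedSum_congr T A B hA fun v hv => LinearMap.ext fun w => by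
        have := hp ⟨v, hv⟩
        simp only at this
        simp [ι₁, this]
    have h3 : T.signedSum B A (Θ.compl₁₂ LinearMap.id (ι₂ ∘ₗ q.toLinearMap)).flip =
        T.signedSum B A Θ.flip :=
      signedSum_congr T B A hB fun v hv => LinearMap.ext fun w => by
        have := hq ⟨v, hv⟩
        simp only at this
        simp [ι₂, this]
    rw [h0, map_zero, h2, ← signedSum_flip, h3, signedSum_flip,
      signedSum_coeffMul T A B hinj] at h1
    exact zero_ne_one h1
  refine ⟨LinearMap.intertwiningMap_of_isIntertwiningMap _ _
    (F ∘ₗ (spechtSubrep lam N).toSubmodule.subtype) fun g v => hF g v, ?_⟩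
  exact injective_comp_subtype_of_polytabloid_ne_zero f T hne

end BijTableau

/-! ### Row and column lengths of the diagram of a partition -/

theorem YoungDiagram.sum_rowLen (μ : YoungDiagram) :
    ∑ i ∈ Finset.range (μ.colLen 0), μ.rowLen i = μ.cells.card := by
  rw [Finset.card_eq_sum_card_fiberwise (f := Prod.fst) (t := Finset.range (μ.colLen 0))]
  · exact Finset.sum_congr rfl fun i _ => μ.rowLen_eq_card
  · intro c hc
    simp only [Finset.coe_range, Set.mem_Iio]
    rw [← YoungDiagram.mem_iff_lt_colLen]
    exact μ.up_left_mem le_rfl (Nat.zero_le _) (show (c.1, c.2) ∈ μ from hc)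

theorem YoungDiagram.rowLen_pos {μ : YoungDiagram} {i : ℕ} :
    0 < μ.rowLen i ↔ i < μ.colLen 0 := by
  rw [← YoungDiagram.mem_iff_lt_rowLen, YoungDiagram.mem_iff_lt_colLen]

theorem YoungDiagram.card_lt_rowLen (μ : YoungDiagram) (k : ℕ) :
    ((Finset.range (μ.colLen 0)).filter fun i => k < μ.rowLen i).card = μ.colLen k := by
  rw [← Finset.card_range (μ.colLen k)]
  congr 1
  ext i
  simp only [Finset.mem_filter, Finset.mem_range]
  rw [← YoungDiagram.rowLen_pos, ← YoungDiagram.mem_iff_lt_colLen,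
    YoungDiagram.mem_iff_lt_rowLen]
  omega

theorem coe_rowLens_partitionDiagram {N : ℕ} (p : N.Partition) :
    ((partitionDiagram p).rowLens : Multiset ℕ) = p.parts := by
  rw [partitionDiagram, YoungDiagram.rowLens_ofRowLens_eq_self, Multiset.sort_eq]
  intro x hx
  exact p.parts_pos (by simpa using hx)

theorem card_cells_partitionDiagram {N : ℕ} (p : N.Partition) :
    (partitionDiagram p).cells.card = N := by
  have h := p.parts_sum
  rw [← coe_rowLens_partitionDiagram p] at h
  rw [← YoungDiagram.sum_rowLen]
  exact h

/-- Counting values above each bound reads off the conjugate partition, which ignores order and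
zeros. -/
theorem PartsAre.card_lt {N : ℕ} {ι : Type*} [Fintype ι] {p : N.Partition} {f : ι → ℕ}
    (h : PartsAre p f) (k : ℕ) :
    (Finset.univ.filter fun c => k < f c).card = (partitionDiagram p).colLen k := by
  have h1 : p.parts.countP (k < ·) = (partitionDiagram p).colLen k := by
    rw [← coe_rowLens_partitionDiagram p, ← YoungDiagram.card_lt_rowLen]
    change Multiset.countP _ ((Multiset.range _).map _) = _
    rw [Multiset.countP_map]
    rfl
  rw [← h1, h, Multiset.countP_filter, Multiset.countP_map]
  change Multiset.card _ = _
  congr 1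
  refine Multiset.filter_congr fun c _ => ?_
  omega

theorem PartsAre.rowLen_eq {N m : ℕ} {p : N.Partition} {f : Fin m → ℕ} (h : PartsAre p f)
    (hf : Antitone f) (i : Fin m) : (partitionDiagram p).rowLen i = f i := by
  refine eq_of_forall_lt_iff fun k => ?_
  rw [← YoungDiagram.mem_iff_lt_rowLen, YoungDiagram.mem_iff_lt_colLen, ← h.card_lt k]
  exact Fin.lt_card_filter_univ_iff_apply_of_imp (fun i => k < f i)
    fun a b hab hb => hb.trans_le (hf hab)

theorem PartsAre.colLen_le {N m : ℕ} {p : N.Partition} {f : Fin m → ℕ} (h : PartsAre p f) (k : ℕ) :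
    (partitionDiagram p).colLen k ≤ m := by
  rw [← h.card_lt k]
  exact (Finset.card_filter_le _ _).trans (by simp)

theorem Fintype.card_fiber_add_card_lt {ι : Type*} [Fintype ι] (f : ι → ℕ) {v : ℕ} (hv : v ≠ 0) :
    Fintype.card {c // f c = v} + (Finset.univ.filter fun c => v < f c).card =
      (Finset.univ.filter fun c => v - 1 < f c).card := by
  classical
  rw [Fintype.card_subtype, ← Finset.card_union_of_disjoint]
  · congr 1
    ext c
    simp only [Finset.mem_union, Finset.mem_filter, Finset.mem_univ, true_and]
    omega
  · refine Finset.disjoint_filter.2 fun c _ h1 h2 => ?_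
    omega

/-- A finite family with as many values above each bound as the row lengths of a Young diagram
matches these row lengths. -/
theorem YoungDiagram.exists_equiv_rowLen {ι : Type*} [Fintype ι] (μ : YoungDiagram) (f : ι → ℕ)
    (h : ∀ k, (Finset.univ.filter fun c => k < f c).card = μ.colLen k) :
    ∃ e : {c // f c ≠ 0} ≃ Fin (μ.colLen 0), ∀ c, μ.rowLen (e c) = f c := by
  classical
  have h' : ∀ k, (Finset.univ.filter fun i : Fin (μ.colLen 0) => k < μ.rowLen i).card =
      μ.colLen k := fun k => by
    rw [← μ.card_lt_rowLen k, Finset.card_filter, Finset.card_filter,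
      Fin.sum_univ_eq_sum_range (fun i => if k < μ.rowLen i then 1 else 0)]
  -- The number of values equal to `v ≠ 0` is a difference of two counts of values above a bound, so
  -- corresponding fibres have equal size.
  have hfib : ∀ v, Nonempty ({c : {c // f c ≠ 0} // f c = v} ≃
      {i : Fin (μ.colLen 0) // μ.rowLen i = v}) := by
    intro v
    rcases eq_or_ne v 0 with rfl | hv
    · have h1 : IsEmpty {c : {c // f c ≠ 0} // f c = 0} := ⟨fun c => c.1.2 c.2⟩
      have h2 : IsEmpty {i : Fin (μ.colLen 0) // μ.rowLen i = 0} :=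
        ⟨fun i => (YoungDiagram.rowLen_pos.2 i.1.2).ne' i.2⟩
      exact ⟨Equiv.equivOfIsEmpty _ _⟩
    · refine ⟨(Equiv.subtypeSubtypeEquivSubtype fun {c} (hc : f c = v) => hc ▸ hv).trans
        (Fintype.equivOfCardEq ?_)⟩
      have h1 := Fintype.card_fiber_add_card_lt f hv
      have h2 := Fintype.card_fiber_add_card_lt (fun i : Fin (μ.colLen 0) => μ.rowLen i) hv
      rw [h, h] at h1
      rw [h', h'] at h2
      omega
  exact ⟨Equiv.ofFiberEquiv fun v => (hfib v).some, fun c => Equiv.ofFiberEquiv_map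
    (f := fun c : {c // f c ≠ 0} => f c) (g := fun i : Fin (μ.colLen 0) => μ.rowLen i) _ c⟩

/-! ### Tableaux from the slices of a plane partition -/

/-- An enumeration of the boxes of a stack of height `t` gives a tableau whose rows are the slices in
the first direction and whose columns are the lines in that direction. -/
theorem exists_bijTableau_of_slices {m n N : ℕ} {p : N.Partition} {t : Fin m → Fin n → ℕ}
    (hcol : ∀ j, Antitone fun i => t i j) (hp : PartsAre p fun i => ∑ j, t i j)
    {X : Fin N → Fin m} {Y : Fin N → Fin n} {Z : Fin N → ℕ} (hZ : ∀ x, Z x < t (X x) (Y x))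
    (hinj : ∀ x y, X x = X y → Y x = Y y → Z x = Z y → x = y) :
    ∃ A : BijTableau (partitionDiagram p) N, (∀ x, A.rowIdx x = X x) ∧
      ∀ x y, A.colIdx x = A.colIdx y → Y x = Y y ∧ Z x = Z y := by
  classical
  set μ := partitionDiagram p with hμ
  have hanti : Antitone fun i => ∑ j, t i j := fun a b hab =>
    Finset.sum_le_sum fun j _ => hcol j hab
  obtain ⟨K, hK⟩ : ∃ K, ∀ i j, t i j ≤ K :=
    ⟨∑ i, ∑ j, t i j, fun i j =>
      (Finset.single_le_sum (f := fun j => t i j) (fun _ _ => Nat.zero_le _)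
        (Finset.mem_univ j)).trans
      (Finset.single_le_sum (f := fun i => ∑ j, t i j) (fun _ _ => Nat.zero_le _)
        (Finset.mem_univ i))⟩
  -- `H (j, k)` is the length of the line of boxes over `(j, k)` in the first direction; `K` only
  -- makes the index set finite.
  let H : Fin n × Fin K → ℕ := fun c => (Finset.univ.filter fun i => (c.2 : ℕ) < t i c.1).card
  have hH : ∀ (i : Fin m) c, (i : ℕ) < H c ↔ (c.2 : ℕ) < t i c.1 := fun i c =>
    Fin.lt_card_filter_univ_iff_apply_of_imp (fun i => (c.2 : ℕ) < t i c.1)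
      fun a b hab hb => hb.trans_le (hcol c.1 hab)
  have hHm : ∀ c, H c ≤ m := fun c => (Finset.card_filter_le _ _).trans (by simp)
  -- The lines longer than `i` are those meeting slice `i`, and there are as many as boxes in it,
  -- namely the `i`-th part. Hence the nonempty lines match the columns of `μ` in length.
  obtain ⟨e, he⟩ := μ.transpose.exists_equiv_rowLen H fun i => by
    rw [YoungDiagram.colLen_transpose]
    rcases lt_or_ge i m with hi | hi
    · rw [hμ, hp.rowLen_eq hanti ⟨i, hi⟩]
      simp only [hH ⟨i, hi⟩]
      rw [← Finset.univ_product_univ, Finset.card_filter, Finset.sum_product]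
      refine Finset.sum_congr rfl fun j _ => ?_
      rw [← Finset.card_filter]
      exact Fin.card_filter_val_lt.trans (min_eq_right (hK _ _))
    · rw [Finset.filter_false_of_mem fun c _ => not_lt.2 ((hHm c).trans hi), Finset.card_empty]
      by_contra h0
      have := YoungDiagram.rowLen_pos.1 (Nat.pos_of_ne_zero (Ne.symm h0))
      exact absurd (this.trans_le (hp.colLen_le 0)) (not_lt.2 hi)
  have hHx : ∀ x, (X x : ℕ) < H (Y x, ⟨Z x, (hZ x).trans_le (hK _ _)⟩) := fun x =>
    (hH _ _).2 (hZ x)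
  let c : Fin N → {c // H c ≠ 0} := fun x => ⟨_, (Nat.zero_lt_of_lt (hHx x)).ne'⟩
  let g : Fin N → {c // c ∈ μ.cells} := fun x => ⟨(X x, e (c x)), by
    rw [YoungDiagram.mem_cells, YoungDiagram.mem_iff_lt_colLen, ← YoungDiagram.rowLen_transpose, he]
    exact hHx x⟩
  have hc : ∀ x y, (e (c x) : ℕ) = e (c y) → Y x = Y y ∧ Z x = Z y := by
    intro x y h
    simpa [c] using e.injective (Fin.ext h)
  have hg : Function.Injective g := by
    intro x y h
    simp only [g, Subtype.mk.injEq, Prod.mk.injEq] at h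
    obtain ⟨h1, h2⟩ := hc x y h.2
    exact hinj x y (Fin.ext h.1) h1 h2
  have hbij : Function.Bijective g := (Fintype.bijective_iff_injective_and_card g).2
    ⟨hg, by rw [Fintype.card_coe, hμ, card_cells_partitionDiagram, Fintype.card_fin]⟩
  exact ⟨(Equiv.ofBijective g hbij).symm, fun x => rfl, fun x y h => hc x y h⟩

theorem mainTheorem7 (m n N : ℕ) (γ α β : N.Partition) (t : Fin m → Fin n → ℕ)
    (hrow : ∀ i, Antitone fun j => t i j)
    (hcol : ∀ j, Antitone fun i => t i j)
    (hγ : PartsAre γ fun c : Fin m × Fin n => t c.1 c.2)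
    (hα : PartsAre α fun i => ∑ j, t i j)
    (hβ : PartsAre β fun j => ∑ i, t i j) :
    AppearsIn (spechtRep γ) (Representation.tprod (spechtRep α) (spechtRep β)) := by
  -- `e` matches the nonzero positions of `t` with the rows of the diagram of `γ`, so an entry of
  -- `T` gets its position `(X, Y)` from its row and its height from its column.
  obtain ⟨e, he⟩ := (partitionDiagram γ).exists_equiv_rowLen _ hγ.card_lt
  let T : BijTableau (partitionDiagram γ) N := Fintype.equivOfCardEq (by
    rw [Fintype.card_coe, card_cells_partitionDiagram, Fintype.card_fin])
  have hr : ∀ x, T.colIdx x < (partitionDiagram γ).rowLen (T.rowIdx x) := fun x =>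
    YoungDiagram.mem_iff_lt_rowLen.1 (T.symm x).2
  let r : Fin N → Fin ((partitionDiagram γ).colLen 0) := fun x =>
    ⟨T.rowIdx x, YoungDiagram.rowLen_pos.1 (Nat.zero_lt_of_lt (hr x))⟩
  let X : Fin N → Fin m := fun x => (e.symm (r x)).1.1
  let Y : Fin N → Fin n := fun x => (e.symm (r x)).1.2
  have hZ : ∀ x, T.colIdx x < t (X x) (Y x) := fun x => by
    have := he (e.symm (r x))
    rw [e.apply_symm_apply] at this
    exact (hr x).trans_eq this
  have hXY : ∀ x y, T.rowIdx x = T.rowIdx y → X x = X y ∧ Y x = Y y := fun x y h => by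
    have : r x = r y := Fin.ext h
    exact ⟨by simp only [X, this], by simp only [Y, this]⟩
  have hinj : ∀ x y, X x = X y → Y x = Y y → T.colIdx x = T.colIdx y → x = y := by
    intro x y h1 h2 h3
    refine T.idx_injective ?_ h3
    exact congrArg Fin.val (e.symm.injective (Subtype.ext (Prod.ext h1 h2)) : r x = r y)
  obtain ⟨A, hA, hA'⟩ := exists_bijTableau_of_slices hcol hα hZ hinj
  obtain ⟨B, hB, hB'⟩ := exists_bijTableau_of_slices (t := fun j i => t i j) hrow hβ hZ
    fun x y h1 h2 => hinj x y h2 h1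
  refine BijTableau.appearsIn_tprod T A B (fun x y h => ?_) (fun x y h => ?_) (fun x y h => ?_)
    fun x y h1 h2 => ?_
  · rw [hA, hA, hB, hB, (hXY x y h).1, (hXY x y h).2]
    exact ⟨rfl, rfl⟩
  · rw [hB, hB, (hA' x y h).1]
    exact ⟨rfl, (hA' x y h).2⟩
  · rw [hA, hA, (hB' x y h).1]
    exact ⟨rfl, (hB' x y h).2⟩
  · rw [hA, hA] at h1
    rw [hB, hB] at h2
    exact hinj x y (Fin.ext h1) (Fin.ext h2)
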